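/- Consider an initially straight, axially inextensible cantilever of length $L>0$ and bending stiffness $EI>0$, clamped at its right end $x=L$ and loaded at its free left end $x=0$ by a force of magnitude $F\ge 0$ inclined by the angle $\alpha\in[0,\pi)$ to the beam axis, without end moment. An equilibrium state consists of a rotation $\varphi$ and centerline displacements $u_s,w_s$ on $[0,L]$ with $$EI\,\varphi'=F\cos\alpha\,(w_s-w_s(0))-F\sin\alpha\,(x+u_s-u_s(0)),\qquad u_s'=\cos\varphi-1,\qquad w_s'=-\sin\varphi,$$ $$\varphi(L)=u_s(L)=w_s(L)=0 .$$ Let $\mathrm{F_J}(\varphi,k)=\int_0^\varphi\frac{dt}{\sqrt{1-k^2\sin^2t}}$, $\mathrm{E_J}(\varphi,k)=\int_0^\varphi\sqrt{1-k^2\sin^2t}\,dt$, $\mathrm K(k)=\mathrm{F_J}(\pi/2,k)$, $\mathrm E(k)=\mathrm{E_J}(\pi/2,k)$, and, with $\theta(\varphi)=\arcsin\sqrt{\frac{1-\cos\alpha}{1-\cos(\alpha+\varphi)}}$, $$B(\varphi)=\mathrm K\!\left(\sin\tfrac{\alpha+\varphi}2\right)-\mathrm{F_J}\!\left(\theta(\varphi),\sin\tfrac{\alpha+\varphi}2\right),\qquad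 D(\varphi)=\mathrm{E_J}\!\left(\theta(\varphi),\sin\tfrac{\alpha+\varphi}2\right).$$ (1) For every equilibrium state whose curvature $\varphi'$ is negative on $(0,L]$, the end rotation $\varphi_a=\varphi(0)$ satisfies $\varphi_a>0$, $\alpha+\varphi_a<\pi$ and $B(\varphi_a)>0$, and $$L\sqrt{F/EI}=B(\varphi_a),\qquad F=\frac{EI}{L^2}B(\varphi_a)^2,$$ $$u_a=u_s(0)=L(1+\cos\alpha)-\frac{L\sin\alpha}{B(\varphi_a)}\sqrt{2\cos\alpha-2\cos(\alpha+\varphi_a)}-\frac{2L\cos\alpha}{B(\varphi_a)}\left(\mathrm E\!\left(\sin\tfrac{\alpha+\varphi_a}2\right)-D(\varphi_a)\right),$$ $$w_a=w_s(0)=L\sin\alpha+\frac{L\cos\alpha}{B(\varphi_a)}\sqrt{2\cos\alpha-2\cos(\alpha+\varphi_a)}-\frac{2L\sin\alpha}{B(\varphi_a)}\left(\mathrm E\!\left(\sin\tfrac{\alpha+\varphi_a}2\right)-D(\varphi_a)\right),$$ $$u_F=u_a\cos\alpha+w_a\sin\alpha=L(1+\cos\alpha)-\frac{2L}{B(\varphi_a)}\left(\mathrm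 E\!\left(\sin\tfrac{\alpha+\varphi_a}2\right)-D(\varphi_a)\right).$$ (2) These states are parametrized by the end rotation: for $\varphi_a>0$ with $\alpha+\varphi_a<\pi$ and $F\ge0$, an equilibrium state under the force $F$ with negative curvature on $(0,L]$ and $\varphi(0)=\varphi_a$ exists if and only if $F=\frac{EI}{L^2}B(\varphi_a)^2$. (3) For axial compression, $\alpha=0$, one has $B(\varphi)=\mathrm K(\sin\frac\varphi2)$ and $D(\varphi)=0$ for $0<\varphi<\pi$, and the relations in (1) become $$F=\frac{EI}{L^2}\mathrm K^2\!\left(\sin\tfrac{\varphi_a}2\right),\qquad u_a=2L\left(1-\frac{\mathrm E(\sin\frac{\varphi_a}2)}{\mathrm K(\sin\frac{\varphi_a}2)}\right),\qquad w_a=\frac{2L\sin\frac{\varphi_a}2}{\mathrm K(\sin\frac{\varphi_a}2)} .$$ These three expressions are continuous at $\varphi_a=0$; since $\mathrm K(0)=\mathrm E(0)=\pi/2$, their values there are the Euler critical force $F=\frac{\pi^2EI}{4L^2}$ and zero displacements $u_a=w_a=0$. -/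

import Mathlib

noncomputable section

/-- Incomplete elliptic integral of the first kind, `F_J(φ, k)`. -/
def ellipticFJ (φ k : ℝ) : ℝ :=
  ∫ t in (0 : ℝ)..φ, 1 / Real.sqrt (1 - k ^ 2 * Real.sin t ^ 2)

/-- Incomplete elliptic integral of the second kind, `E_J(φ, k)`. -/
def ellipticEJ (φ k : ℝ) : ℝ :=
  ∫ t in (0 : ℝ)..φ, Real.sqrt (1 - k ^ 2 * Real.sin t ^ 2)

/-- Complete elliptic integral of the first kind, `K(k)`. -/
def ellipticK (k : ℝ) : ℝ := ellipticFJ (Real.pi / 2) k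

/-- Complete elliptic integral of the second kind, `E(k)`. -/
def ellipticE (k : ℝ) : ℝ := ellipticEJ (Real.pi / 2) k

/-- Fundamental equations of an initially straight, axially inextensible, shear-rigid elastic beam
of length `L` and bending stiffness `EI`. Here `X`, `Z`, `M` are the left-end forces and the
left-end moment, `φ` is the sectional rotation, and `u`, `w` are the centerline displacements, all
as functions of the initial coordinate `x ∈ [0, L]` (one-sided derivatives at the two ends). -/
structure IsInextensibleBeam (EI L X Z M : ℝ) (φ u w : ℝ → ℝ) : Prop where
  moment : ∀ x ∈ Set.Icc 0 L, HasDerivWithinAt φ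
    ((-M + X * (w x - w 0) - Z * (x + u x - u 0)) / EI) (Set.Icc 0 L) x
  axial : ∀ x ∈ Set.Icc 0 L, HasDerivWithinAt u (Real.cos (φ x) - 1) (Set.Icc 0 L) x
  transversal : ∀ x ∈ Set.Icc 0 L, HasDerivWithinAt w (-Real.sin (φ x)) (Set.Icc 0 L) x

/-- Curvature `κ = φ'` of a beam occupying `[0, L]`. -/
def beamCurvature (L : ℝ) (φ : ℝ → ℝ) (x : ℝ) : ℝ := derivWithin φ (Set.Icc 0 L) x

/-- Equilibrium state of an inextensible cantilever clamped at its right end `x = L` and loaded at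
its left end `x = 0` by a force of magnitude `F` that deviates by the angle `α` from the beam
axis, with no end moment. -/
structure IsCantileverState (EI L α F : ℝ) (φ u w : ℝ → ℝ) : Prop where
  beam : IsInextensibleBeam EI L (F * Real.cos α) (F * Real.sin α) 0 φ u w
  clamped_rotation : φ L = 0
  clamped_axial : u L = 0
  clamped_transversal : w L = 0

/-- The auxiliary function `B(φ)` for the inclination `α`. -/
def cantileverB (α φ : ℝ) : ℝ :=
  ellipticK (Real.sin ((α + φ) / 2)) -
    ellipticFJ (Real.arcsin (Real.sqrt ((1 - Real.cos α) / (1 - Real.cos (α + φ)))))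
      (Real.sin ((α + φ) / 2))

/-- The auxiliary function `D(φ)` for the inclination `α`. -/
def cantileverD (α φ : ℝ) : ℝ :=
  ellipticEJ (Real.arcsin (Real.sqrt ((1 - Real.cos α) / (1 - Real.cos (α + φ)))))
    (Real.sin ((α + φ) / 2))

/-- Closed-form force for axial compression, as a function of the end rotation. -/
def axialForce (EI L φ : ℝ) : ℝ := EI / L ^ 2 * ellipticK (Real.sin (φ / 2)) ^ 2

/-- Closed-form axial end displacement for axial compression. -/
def axialU (L φ : ℝ) : ℝ :=
  2 * L * (1 - ellipticE (Real.sin (φ / 2)) / ellipticK (Real.sin (φ / 2)))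

/-- Closed-form transversal end displacement for axial compression. -/
def axialW (L φ : ℝ) : ℝ :=
  2 * L * Real.sin (φ / 2) / ellipticK (Real.sin (φ / 2))

end

/-!
The tangent angle `ψ = α + φ` of an equilibrium state satisfies the pendulum equation
`ψ'' = -(F / EI) sin ψ`, and since no moment acts at the free end, the pendulum is released from
rest. By uniqueness for this equation `ψ` starts below the unstable rest position `π`, and it is the
explicit solution `sin (ψ / 2) = k sin θ` with modulus `k = sin ((α + φ 0) / 2)` and Jacobi
amplitude `θ x = am(K(k) - ω x, k)`, where `ω = √(F / EI)`. The velocity vanishes where `cos θ`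
does, so negative curvature forces `|θ L| < π / 2`, and the clamp condition `ψ L = α` then
determines `θ L` and gives `ω L = B`; read backwards, this yields existence.

In coordinates along and across the load, the displacement of the free end along the load is a
first integral built from the elliptic integral of the second kind, because
`(E_J(θ, k))' = -ω (1 + cos ψ) / 2`, and the displacement across the load follows from conservation
of energy, because the moment is proportional to the lever arm.
-/

section

open Real Set

section EllipticIntegrals

variable {k : ℝ}

/-- The delta amplitude `Δ(t, k) = √(1 - k² sin² t)`, the integrand of `ellipticEJ` and the
reciprocal of the integrand of `ellipticFJ`. -/
noncomputable def jacobiDelta (k t : ℝ) : ℝ := √(1 - k ^ 2 * sin t ^ 2)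

theorem one_sub_sq_mul_sin_sq_pos (hk : k ^ 2 < 1) (t : ℝ) : 0 < 1 - k ^ 2 * sin t ^ 2 :=
  sub_pos.2 ((mul_le_of_le_one_right (sq_nonneg k) (sin_sq_le_one t)).trans_lt hk)

theorem jacobiDelta_pos (hk : k ^ 2 < 1) (t : ℝ) : 0 < jacobiDelta k t :=
  sqrt_pos.2 (one_sub_sq_mul_sin_sq_pos hk t)

theorem jacobiDelta_le_one (k t : ℝ) : jacobiDelta k t ≤ 1 :=
  sqrt_le_one.2 (sub_le_self _ (by positivity))

theorem continuous_jacobiDelta_uncurry : Continuous fun p : ℝ × ℝ => jacobiDelta p.1 p.2 := by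
  unfold jacobiDelta
  fun_prop

theorem continuous_jacobiDelta (k : ℝ) : Continuous (jacobiDelta k) :=
  continuous_jacobiDelta_uncurry.comp (by fun_prop : Continuous fun t : ℝ => (k, t))

theorem ellipticFJ_zero_left (k : ℝ) : ellipticFJ 0 k = 0 := intervalIntegral.integral_same

theorem ellipticEJ_zero_left (k : ℝ) : ellipticEJ 0 k = 0 := intervalIntegral.integral_same

theorem ellipticK_zero : ellipticK 0 = π / 2 := by simp [ellipticK, ellipticFJ]

theorem ellipticE_zero : ellipticE 0 = π / 2 := by simp [ellipticE, ellipticEJ]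

theorem hasDerivAt_ellipticFJ (hk : k ^ 2 < 1) (t : ℝ) :
    HasDerivAt (ellipticFJ · k) (1 / jacobiDelta k t) t :=
  ((continuous_const.div (continuous_jacobiDelta k)
    fun s => (jacobiDelta_pos hk s).ne').integral_hasStrictDerivAt 0 t).hasDerivAt

theorem hasDerivAt_ellipticEJ (k t : ℝ) : HasDerivAt (ellipticEJ · k) (jacobiDelta k t) t :=
  ((continuous_jacobiDelta k).integral_hasStrictDerivAt 0 t).hasDerivAt

theorem monotone_ellipticFJ_sub_id (hk : k ^ 2 < 1) : Monotone fun t => ellipticFJ t k - t := by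
  have hderiv : ∀ t, HasDerivAt (fun t => ellipticFJ t k - t) (1 / jacobiDelta k t - 1) t :=
    fun t => (hasDerivAt_ellipticFJ hk t).sub (hasDerivAt_id t)
  refine monotone_of_hasDerivAt_nonneg hderiv fun t => ?_
  exact sub_nonneg.2 ((one_le_div (jacobiDelta_pos hk t)).2 (jacobiDelta_le_one k t))

theorem strictMono_ellipticFJ (hk : k ^ 2 < 1) : StrictMono (ellipticFJ · k) := by
  simpa using (monotone_ellipticFJ_sub_id hk).add_strictMono strictMono_id

theorem surjective_ellipticFJ (hk : k ^ 2 < 1) : Function.Surjective (ellipticFJ · k) := by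
  have hmono := monotone_ellipticFJ_sub_id hk
  have hcont : Continuous (ellipticFJ · k) :=
    continuous_iff_continuousAt.2 fun t => (hasDerivAt_ellipticFJ hk t).continuousAt
  refine hcont.surjective (Filter.tendsto_atTop_mono' _ ?_ Filter.tendsto_id)
    (Filter.tendsto_atBot_mono' _ ?_ Filter.tendsto_id)
  · filter_upwards [Filter.eventually_ge_atTop 0] with t ht
    simpa [ellipticFJ_zero_left] using hmono ht
  · filter_upwards [Filter.eventually_le_atBot 0] with t ht
    simpa [ellipticFJ_zero_left] using hmono ht

theorem ellipticK_pos (hk : k ^ 2 < 1) : 0 < ellipticK k := by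
  simpa [ellipticK, ellipticFJ_zero_left] using strictMono_ellipticFJ hk pi_div_two_pos

theorem continuousOn_ellipticK : ContinuousOn ellipticK {k | k ^ 2 < 1} := by
  rw [continuousOn_iff_continuous_domRestrict]
  refine intervalIntegral.continuous_parametric_intervalIntegral_of_continuous'
    (f := fun (k : {k : ℝ | k ^ 2 < 1}) t => 1 / jacobiDelta k t) ?_ 0 (π / 2)
  exact continuous_const.div
    (continuous_jacobiDelta_uncurry.comp (continuous_subtype_val.prodMap continuous_id))
    fun p => (jacobiDelta_pos p.1.2 p.2).ne'

theorem continuous_ellipticE : Continuous ellipticE :=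
  intervalIntegral.continuous_parametric_intervalIntegral_of_continuous'
    continuous_jacobiDelta_uncurry 0 (π / 2)

/-- The Jacobi amplitude `am(s, k)`, the inverse of `F_J(·, k)`. It is meaningful only for
`k ^ 2 < 1`, where `F_J(·, k)` is a bijection of the real line. -/
noncomputable def jacobiAm (k : ℝ) : ℝ → ℝ := Function.invFun (ellipticFJ · k)

theorem jacobiAm_ellipticFJ (hk : k ^ 2 < 1) (t : ℝ) : jacobiAm k (ellipticFJ t k) = t :=
  Function.leftInverse_invFun (strictMono_ellipticFJ hk).injective t

theorem ellipticFJ_jacobiAm (hk : k ^ 2 < 1) (s : ℝ) : ellipticFJ (jacobiAm k s) k = s :=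
  Function.rightInverse_invFun (surjective_ellipticFJ hk) s

theorem strictMono_jacobiAm (hk : k ^ 2 < 1) : StrictMono (jacobiAm k) := fun s t hst =>
  (strictMono_ellipticFJ hk).lt_iff_lt.1 (by simpa only [ellipticFJ_jacobiAm hk] using hst)

theorem continuous_jacobiAm (hk : k ^ 2 < 1) : Continuous (jacobiAm k) :=
  (strictMono_jacobiAm hk).monotone.continuous_of_surjective fun t =>
    ⟨ellipticFJ t k, jacobiAm_ellipticFJ hk t⟩

theorem hasDerivAt_jacobiAm (hk : k ^ 2 < 1) (s : ℝ) :
    HasDerivAt (jacobiAm k) (jacobiDelta k (jacobiAm k s)) s := by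
  have hne : 1 / jacobiDelta k (jacobiAm k s) ≠ 0 := (one_div_pos.2 (jacobiDelta_pos hk _)).ne'
  simpa using HasDerivAt.of_local_left_inverse (continuous_jacobiAm hk).continuousAt
    (hasDerivAt_ellipticFJ hk _) hne (.of_forall (ellipticFJ_jacobiAm hk))

end EllipticIntegrals

section Pendulum

theorem eq_of_hasDerivWithinAt_zero {E : Type*} [NormedAddCommGroup E] [NormedSpace ℝ E]
    {f : ℝ → E} {s : Set ℝ} (hs : Convex ℝ s) (hf : ∀ x ∈ s, HasDerivWithinAt f 0 s x) {x y : ℝ}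
    (hx : x ∈ s) (hy : y ∈ s) : f x = f y := by
  have := hs.norm_image_sub_le_of_norm_hasDerivWithin_le hf (C := 0) (by simp) hy hx
  simpa [sub_eq_zero] using this

/-- `ψ` and `κ` are the angle and the angular velocity of a pendulum, `ψ'' = -c sin ψ`, on `s`.
The tangent angle of a buckled beam obeys this equation in the arc length. -/
structure IsPendulumOn (c : ℝ) (s : Set ℝ) (ψ κ : ℝ → ℝ) : Prop where
  hasDerivWithinAt_angle : ∀ x ∈ s, HasDerivWithinAt ψ (κ x) s x
  hasDerivWithinAt_velocity : ∀ x ∈ s, HasDerivWithinAt κ (-(c * sin (ψ x))) s x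

namespace IsPendulumOn

variable {a b c x y : ℝ} {s : Set ℝ} {ψ κ : ℝ → ℝ}

theorem mono {t : Set ℝ} (h : IsPendulumOn c s ψ κ) (hts : t ⊆ s) : IsPendulumOn c t ψ κ :=
  ⟨fun x hx => (h.hasDerivWithinAt_angle x (hts hx)).mono hts,
    fun x hx => (h.hasDerivWithinAt_velocity x (hts hx)).mono hts⟩

theorem continuousOn_angle (h : IsPendulumOn c s ψ κ) : ContinuousOn ψ s :=
  fun x hx => (h.hasDerivWithinAt_angle x hx).continuousWithinAt

theorem velocity_sq (h : IsPendulumOn c s ψ κ) (hs : Convex ℝ s) (hx : x ∈ s) (hy : y ∈ s) :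
    κ y ^ 2 = κ x ^ 2 + 2 * c * (cos (ψ y) - cos (ψ x)) := by
  have henergy : κ y ^ 2 - 2 * c * cos (ψ y) = κ x ^ 2 - 2 * c * cos (ψ x) := by
    refine eq_of_hasDerivWithinAt_zero (f := fun x => κ x ^ 2 - 2 * c * cos (ψ x)) hs
      (fun z hz => ?_) hy hx
    refine (((h.hasDerivWithinAt_velocity z hz).pow 2).sub
      ((h.hasDerivWithinAt_angle z hz).cos.const_mul (2 * c))).congr_deriv ?_
    ring
  linarith

theorem lipschitzWith_field (c : ℝ) :
    LipschitzWith (max 1 ‖c‖₊) fun p : ℝ × ℝ => (p.2, -(c * sin p.1)) := by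
  have hsin : LipschitzWith ‖c‖₊ fun ψ : ℝ => -(c * sin ψ) := by
    refine lipschitzWith_of_nnnorm_deriv_le (by fun_prop) fun ψ => ?_
    have : deriv (fun ψ => -(c * sin ψ)) ψ = -(c * cos ψ) :=
      ((hasDerivAt_sin ψ).const_mul c).neg.deriv
    rw [this, nnnorm_neg, nnnorm_mul]
    exact mul_le_of_le_one_right' (abs_cos_le_one ψ)
  simpa using LipschitzWith.prod_snd.prodMk (hsin.comp LipschitzWith.prod_fst)

theorem eqOn_Icc {ψ' κ' : ℝ → ℝ} (h : IsPendulumOn c (Icc a b) ψ κ)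
    (h' : IsPendulumOn c (Icc a b) ψ' κ') (hψ : ψ a = ψ' a) (hκ : κ a = κ' a) :
    EqOn ψ ψ' (Icc a b) ∧ EqOn κ κ' (Icc a b) := by
  have hderiv {ψ κ : ℝ → ℝ} (h : IsPendulumOn c (Icc a b) ψ κ) (x : ℝ) (hx : x ∈ Icc a b) :
      HasDerivWithinAt (fun x => (ψ x, κ x)) (κ x, -(c * sin (ψ x))) (Icc a b) x :=
    (h.hasDerivWithinAt_angle x hx).prodMk (h.hasDerivWithinAt_velocity x hx)
  have hright {ψ κ : ℝ → ℝ} (h : IsPendulumOn c (Icc a b) ψ κ) (x : ℝ) (hx : x ∈ Ico a b) :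
      HasDerivWithinAt (fun x => (ψ x, κ x)) (κ x, -(c * sin (ψ x))) (Ici x) x :=
    (hderiv h x (Ico_subset_Icc_self hx)).mono_of_mem_nhdsWithin (Icc_mem_nhdsGE_of_mem hx)
  have heq : EqOn (fun x => (ψ x, κ x)) (fun x => (ψ' x, κ' x)) (Icc a b) :=
    ODE_solution_unique (fun _ => lipschitzWith_field c)
      (fun x hx => (hderiv h x hx).continuousWithinAt) (hright h)
      (fun x hx => (hderiv h' x hx).continuousWithinAt) (hright h') (Prod.ext hψ hκ)
  exact ⟨fun x hx => congrArg Prod.fst (heq hx), fun x hx => congrArg Prod.snd (heq hx)⟩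

theorem const_pi (c : ℝ) (s : Set ℝ) : IsPendulumOn c s (fun _ => π) fun _ => 0 :=
  ⟨fun x _ => hasDerivWithinAt_const x s π, fun x _ => by simpa using hasDerivWithinAt_const x s 0⟩

/-- A pendulum released from rest at or above the upright position `π` could only pass it with
zero velocity, and would then stay there by uniqueness. -/
theorem angle_left_lt_pi (h : IsPendulumOn c (Icc a b) ψ κ) (hc : 0 ≤ c) (hab : a ≤ b)
    (hκa : κ a = 0) (hκb : κ b ≠ 0) (hb : ψ b < π) : ψ a < π := by
  by_contra! hle
  obtain ⟨x, hx, hψx⟩ : π ∈ ψ '' Icc a b :=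
    intermediate_value_Icc' hab h.continuousOn_angle ⟨hb.le, hle⟩
  have hκx : κ x = 0 := by
    have hsq := h.velocity_sq (convex_Icc a b) (left_mem_Icc.2 hab) hx
    rw [hκa, hψx, cos_pi] at hsq
    nlinarith [neg_one_le_cos (ψ a)]
  have hrest := (h.mono (Icc_subset_Icc_left hx.1)).eqOn_Icc (const_pi c _) hψx hκx
  exact hκb (hrest.2 (right_mem_Icc.2 hx.2))

theorem strictAntiOn_angle (h : IsPendulumOn c (Icc a b) ψ κ) (hneg : ∀ x ∈ Ioo a b, κ x < 0) :
    StrictAntiOn ψ (Icc a b) := by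
  refine strictAntiOn_of_hasDerivWithinAt_neg (convex_Icc a b) h.continuousOn_angle
    (fun x hx => (h.hasDerivWithinAt_angle x (interior_subset hx)).mono interior_subset) ?_
  simpa only [interior_Icc] using hneg

end IsPendulumOn

end Pendulum

section ExplicitSolution

variable {k ω L x : ℝ}

/-- The amplitude `am(K(k) - ω x, k)` at the point `x` of a pendulum of frequency `ω` that is
released from rest at `x = 0` at the angle `2 arcsin k`. -/
noncomputable def pendulumAmplitude (k ω x : ℝ) : ℝ := jacobiAm k (ellipticK k - ω * x)

/-- The angle `ψ` of a pendulum of frequency `ω` that is released from rest at `x = 0` at the angle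
`2 arcsin k`, given by `sin (ψ / 2) = k sin θ` with the amplitude `θ`. -/
noncomputable def pendulumAngle (k ω x : ℝ) : ℝ := 2 * arcsin (k * sin (pendulumAmplitude k ω x))

/-- The angular velocity `ψ'` of the pendulum with the angle `pendulumAngle`. -/
noncomputable def pendulumVelocity (k ω x : ℝ) : ℝ := -(2 * k * ω * cos (pendulumAmplitude k ω x))

theorem pendulumAmplitude_eq_iff (hk : k ^ 2 < 1) {t : ℝ} :
    pendulumAmplitude k ω x = t ↔ ω * x = ellipticK k - ellipticFJ t k := by
  rw [← (strictMono_ellipticFJ hk).injective.eq_iff, pendulumAmplitude, ellipticFJ_jacobiAm hk,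
    sub_eq_iff_eq_add, eq_sub_iff_add_eq', eq_comm]

theorem pendulumAmplitude_zero (hk : k ^ 2 < 1) (ω : ℝ) : pendulumAmplitude k ω 0 = π / 2 := by
  rw [pendulumAmplitude_eq_iff hk, mul_zero, ellipticK, sub_self]

theorem strictAnti_pendulumAmplitude (hk : k ^ 2 < 1) (hω : 0 < ω) :
    StrictAnti (pendulumAmplitude k ω) := fun _ _ hxy =>
  strictMono_jacobiAm hk (sub_lt_sub_left (mul_lt_mul_of_pos_left hxy hω) _)

theorem hasDerivAt_pendulumAmplitude (hk : k ^ 2 < 1) (ω x : ℝ) :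
    HasDerivAt (pendulumAmplitude k ω) (-(ω * jacobiDelta k (pendulumAmplitude k ω x))) x := by
  refine ((hasDerivAt_jacobiAm hk _).comp x
    ((hasDerivAt_const_mul ω).const_sub (ellipticK k))).congr_deriv ?_
  rw [mul_neg, mul_comm, pendulumAmplitude]

theorem abs_mul_sin_lt_one (hk : k ^ 2 < 1) (t : ℝ) : |k * sin t| < 1 := by
  rw [← sq_lt_one_iff_abs_lt_one, mul_pow]
  linarith [one_sub_sq_mul_sin_sq_pos hk t]

theorem sin_half_pendulumAngle (hk : k ^ 2 < 1) (ω x : ℝ) :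
    sin (pendulumAngle k ω x / 2) = k * sin (pendulumAmplitude k ω x) := by
  have hlt := abs_lt.1 (abs_mul_sin_lt_one hk (pendulumAmplitude k ω x))
  rw [pendulumAngle, mul_div_cancel_left₀ _ two_ne_zero, sin_arcsin hlt.1.le hlt.2.le]

theorem cos_half_pendulumAngle (k ω x : ℝ) :
    cos (pendulumAngle k ω x / 2) = jacobiDelta k (pendulumAmplitude k ω x) := by
  rw [pendulumAngle, mul_div_cancel_left₀ _ two_ne_zero, cos_arcsin, mul_pow, jacobiDelta]

theorem hasDerivAt_pendulumAngle (hk : k ^ 2 < 1) (ω x : ℝ) :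
    HasDerivAt (pendulumAngle k ω) (pendulumVelocity k ω x) x := by
  have hlt := abs_lt.1 (abs_mul_sin_lt_one hk (pendulumAmplitude k ω x))
  have hΔ := (jacobiDelta_pos hk (pendulumAmplitude k ω x)).ne'
  refine (((hasDerivAt_arcsin hlt.1.ne' hlt.2.ne).comp x
    ((hasDerivAt_pendulumAmplitude hk ω x).sin.const_mul k)).const_mul 2).congr_deriv ?_
  rw [mul_pow, ← jacobiDelta, pendulumVelocity]
  field_simp

theorem hasDerivAt_pendulumVelocity (hk : k ^ 2 < 1) (ω x : ℝ) :
    HasDerivAt (pendulumVelocity k ω) (-(ω ^ 2 * sin (pendulumAngle k ω x))) x := by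
  refine ((hasDerivAt_pendulumAmplitude hk ω x).cos.const_mul (2 * k * ω)).neg.congr_deriv ?_
  rw [← mul_div_cancel₀ (pendulumAngle k ω x) two_ne_zero, sin_two_mul, sin_half_pendulumAngle hk,
    cos_half_pendulumAngle]
  ring

theorem isPendulumOn_pendulumAngle (hk : k ^ 2 < 1) (ω : ℝ) (s : Set ℝ) :
    IsPendulumOn (ω ^ 2) s (pendulumAngle k ω) (pendulumVelocity k ω) :=
  ⟨fun x _ => (hasDerivAt_pendulumAngle hk ω x).hasDerivWithinAt,
    fun x _ => (hasDerivAt_pendulumVelocity hk ω x).hasDerivWithinAt⟩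

theorem pendulumAngle_zero (hk : k ^ 2 < 1) (ω : ℝ) : pendulumAngle k ω 0 = 2 * arcsin k := by
  rw [pendulumAngle, pendulumAmplitude_zero hk, sin_pi_div_two, mul_one]

theorem pendulumVelocity_zero (hk : k ^ 2 < 1) (ω : ℝ) : pendulumVelocity k ω 0 = 0 := by
  rw [pendulumVelocity, pendulumAmplitude_zero hk, cos_pi_div_two, mul_zero, neg_zero]

theorem sin_half_sq_lt_one {ψ : ℝ} (h : |ψ| < π) : sin (ψ / 2) ^ 2 < 1 := by
  obtain ⟨hgt, hlt⟩ := abs_lt.1 h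
  have hcos : 0 < cos (ψ / 2) := cos_pos_of_mem_Ioo ⟨by linarith, by linarith⟩
  rw [sin_sq]
  exact sub_lt_self 1 (by positivity)

theorem two_mul_arcsin_sin_half {ψ : ℝ} (h : |ψ| ≤ π) : 2 * arcsin (sin (ψ / 2)) = ψ := by
  rw [arcsin_sin (by linarith [(abs_le.1 h).1]) (by linarith [(abs_le.1 h).2]),
    mul_div_cancel₀ _ two_ne_zero]

theorem IsPendulumOn.eqOn_pendulumAngle {ψ κ : ℝ → ℝ} (h : IsPendulumOn (ω ^ 2) (Icc 0 L) ψ κ)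
    (hψ : |ψ 0| < π) (hκ : κ 0 = 0) :
    EqOn ψ (pendulumAngle (sin (ψ 0 / 2)) ω) (Icc 0 L) ∧
      EqOn κ (pendulumVelocity (sin (ψ 0 / 2)) ω) (Icc 0 L) := by
  have hk := sin_half_sq_lt_one hψ
  refine h.eqOn_Icc (isPendulumOn_pendulumAngle hk ω _) ?_ ?_
  · rw [pendulumAngle_zero hk, two_mul_arcsin_sin_half hψ.le]
  · rw [hκ, pendulumVelocity_zero hk]

theorem hasDerivAt_ellipticEJ_pendulumAmplitude (hk : k ^ 2 < 1) (ω x : ℝ) :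
    HasDerivAt (fun x => 2 * ellipticEJ (pendulumAmplitude k ω x) k)
      (-(ω * (1 + cos (pendulumAngle k ω x)))) x := by
  refine (((hasDerivAt_ellipticEJ k _).comp x
    (hasDerivAt_pendulumAmplitude hk ω x)).const_mul 2).congr_deriv ?_
  rw [← mul_div_cancel₀ (pendulumAngle k ω x) two_ne_zero, cos_two_mul, cos_half_pendulumAngle]
  ring

theorem pendulumAmplitude_mem_Ioo (hk : k ^ 2 < 1) (hω : 0 < ω) (hL : 0 < L)
    (hne : ∀ x ∈ Ioc 0 L, pendulumVelocity k ω x ≠ 0) :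
    pendulumAmplitude k ω L ∈ Ioo (-(π / 2)) (π / 2) := by
  have hzero := pendulumAmplitude_zero hk ω
  refine ⟨?_, hzero ▸ strictAnti_pendulumAmplitude hk hω hL⟩
  by_contra! hle
  obtain ⟨x, hx, hxθ⟩ : -(π / 2) ∈ pendulumAmplitude k ω '' Icc 0 L :=
    intermediate_value_Icc' hL.le
      (fun x _ => (hasDerivAt_pendulumAmplitude hk ω x).continuousAt.continuousWithinAt)
      ⟨hle, by linarith [pi_pos]⟩
  have hx0 : x ≠ 0 := by
    rintro rfl
    linarith [pi_pos]
  refine hne x ⟨hx.1.lt_of_ne' hx0, hx.2⟩ ?_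
  rw [pendulumVelocity, hxθ, cos_neg, cos_pi_div_two, mul_zero, neg_zero]

theorem pendulumVelocity_neg (hk : k ^ 2 < 1) (hk0 : 0 < k) (hω : 0 < ω) (hx : 0 < x)
    (hθ : -(π / 2) < pendulumAmplitude k ω x) : pendulumVelocity k ω x < 0 := by
  have hlt : pendulumAmplitude k ω x < π / 2 :=
    pendulumAmplitude_zero hk ω ▸ strictAnti_pendulumAmplitude hk hω hx
  have := cos_pos_of_mem_Ioo ⟨hθ, hlt⟩
  exact neg_neg_of_pos (by positivity)

end ExplicitSolution

section ClampAmplitude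

variable {α φ : ℝ}

/-- The amplitude `θ(φ)` at the clamped end of a cantilever with inclination `α` of the load and
rotation `φ` of the free end. -/
noncomputable def clampAmplitude (α φ : ℝ) : ℝ := arcsin √((1 - cos α) / (1 - cos (α + φ)))

theorem clampAmplitude_eq_arcsin (hα : 0 ≤ α) (hφ : 0 ≤ φ) (h : α + φ ≤ 2 * π) :
    clampAmplitude α φ = arcsin (sin (α / 2) / sin ((α + φ) / 2)) := by
  rw [clampAmplitude, sin_half_eq_sqrt hα (by linarith), sin_half_eq_sqrt (by linarith) h,
    ← sqrt_div' _ (by linarith [cos_le_one (α + φ)]), div_div_div_cancel_right₀ two_ne_zero]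

theorem sin_half_mul_sin_clampAmplitude (hα : 0 ≤ α) (hφ : 0 < φ) (h : α + φ ≤ π) :
    sin ((α + φ) / 2) * sin (clampAmplitude α φ) = sin (α / 2) := by
  have hpos : 0 < sin ((α + φ) / 2) := sin_pos_of_pos_of_lt_pi (by linarith) (by linarith [pi_pos])
  have hnonneg : 0 ≤ sin (α / 2) := sin_nonneg_of_nonneg_of_le_pi (by linarith) (by linarith)
  have hle : sin (α / 2) ≤ sin ((α + φ) / 2) :=
    sin_le_sin_of_le_of_le_pi_div_two (by linarith) (by linarith) (by linarith)
  rw [clampAmplitude_eq_arcsin hα hφ.le (by linarith),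
    sin_arcsin (by linarith [div_nonneg hnonneg hpos.le]) ((div_le_one hpos).2 hle),
    mul_div_cancel₀ _ hpos.ne']

theorem clampAmplitude_nonneg (α φ : ℝ) : 0 ≤ clampAmplitude α φ := arcsin_nonneg.2 (sqrt_nonneg _)

theorem clampAmplitude_lt_pi_div_two (hα : 0 ≤ α) (hφ : 0 < φ) (h : α + φ ≤ π) :
    clampAmplitude α φ < π / 2 := by
  have hcos : cos (α + φ) < cos α := cos_lt_cos_of_nonneg_of_le_pi hα h (by linarith)
  rw [clampAmplitude, arcsin_lt_pi_div_two, sqrt_lt' one_pos, one_pow,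
    div_lt_one (by linarith [cos_le_one α])]
  linarith

theorem cantileverB_eq (α φ : ℝ) :
    cantileverB α φ = ellipticK (sin ((α + φ) / 2)) -
      ellipticFJ (clampAmplitude α φ) (sin ((α + φ) / 2)) := rfl

theorem cantileverB_pos (hα : 0 ≤ α) (hφ : 0 < φ) (h : α + φ < π) : 0 < cantileverB α φ := by
  have hk := sin_half_sq_lt_one (abs_lt.2 ⟨by linarith, h⟩)
  exact sub_pos.2 (strictMono_ellipticFJ hk (clampAmplitude_lt_pi_div_two hα hφ h.le))

theorem cantileverB_axial (φ : ℝ) : cantileverB 0 φ = ellipticK (sin (φ / 2)) := by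
  simp [cantileverB, ellipticFJ_zero_left]

theorem cantileverD_axial (φ : ℝ) : cantileverD 0 φ = 0 := by
  simp [cantileverD, ellipticEJ_zero_left]

end ClampAmplitude

section LoadFrame

variable {EI L α F x : ℝ} {φ u w : ℝ → ℝ}

/-- Coordinate of the deformed centerline point `(x + u x, w x)` along the direction of the load,
which is inclined by `α`. -/
noncomputable def loadAbscissa (α : ℝ) (u w : ℝ → ℝ) (x : ℝ) : ℝ :=
  cos α * (x + u x) + sin α * w x

/-- Coordinate of the deformed centerline point `(x + u x, w x)` across the direction of the load,
which is inclined by `α`. -/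
noncomputable def loadOrdinate (α : ℝ) (u w : ℝ → ℝ) (x : ℝ) : ℝ :=
  cos α * w x - sin α * (x + u x)

/-- Curvature prescribed by the moment balance of a cantilever without end moment: the lever arm of
the load is the distance from its line of action. -/
noncomputable def momentCurvature (EI α F : ℝ) (u w : ℝ → ℝ) (x : ℝ) : ℝ :=
  F / EI * (loadOrdinate α u w x - loadOrdinate α u w 0)

theorem momentCurvature_zero (EI α F : ℝ) (u w : ℝ → ℝ) : momentCurvature EI α F u w 0 = 0 := by
  rw [momentCurvature, sub_self, mul_zero]

/-- The `-0` is the absent end moment `-M` in `IsInextensibleBeam.moment`. -/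
theorem momentCurvature_eq (EI α F : ℝ) (u w : ℝ → ℝ) (x : ℝ) :
    momentCurvature EI α F u w x =
      (-0 + F * cos α * (w x - w 0) - F * sin α * (x + u x - u 0)) / EI := by
  simp only [momentCurvature, loadOrdinate]
  ring

theorem cos_mul_loadAbscissa_sub (α : ℝ) (u w : ℝ → ℝ) (x : ℝ) :
    cos α * loadAbscissa α u w x - sin α * loadOrdinate α u w x = x + u x := by
  simp only [loadAbscissa, loadOrdinate]
  linear_combination (x + u x) * sin_sq_add_cos_sq α

theorem sin_mul_loadAbscissa_add (α : ℝ) (u w : ℝ → ℝ) (x : ℝ) :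
    sin α * loadAbscissa α u w x + cos α * loadOrdinate α u w x = w x := by
  simp only [loadAbscissa, loadOrdinate]
  linear_combination w x * sin_sq_add_cos_sq α

theorem hasDerivWithinAt_loadAbscissa {s : Set ℝ} (hu : HasDerivWithinAt u (cos (φ x) - 1) s x)
    (hw : HasDerivWithinAt w (-sin (φ x)) s x) :
    HasDerivWithinAt (loadAbscissa α u w) (cos (α + φ x)) s x := by
  refine ((((hasDerivWithinAt_id x s).add hu).const_mul (cos α)).add
    (hw.const_mul (sin α))).congr_deriv ?_
  rw [cos_add]
  ring

theorem hasDerivWithinAt_momentCurvature {s : Set ℝ}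
    (hu : HasDerivWithinAt u (cos (φ x) - 1) s x) (hw : HasDerivWithinAt w (-sin (φ x)) s x) :
    HasDerivWithinAt (momentCurvature EI α F u w) (-(F / EI * sin (α + φ x))) s x := by
  refine ((((hw.const_mul (cos α)).sub (((hasDerivWithinAt_id x s).add hu).const_mul
    (sin α))).sub_const _).const_mul (F / EI)).congr_deriv ?_
  rw [sin_add]
  ring

theorem IsCantileverState.isPendulumOn (h : IsCantileverState EI L α F φ u w) :
    IsPendulumOn (F / EI) (Icc 0 L) (fun x => α + φ x) (momentCurvature EI α F u w) where
  hasDerivWithinAt_angle x hx :=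
    ((h.beam.moment x hx).const_add α).congr_deriv (momentCurvature_eq EI α F u w x).symm
  hasDerivWithinAt_velocity x hx :=
    hasDerivWithinAt_momentCurvature (h.beam.axial x hx) (h.beam.transversal x hx)

theorem beamCurvature_eq {κ : ℝ} (hx : x ∈ Ioc 0 L) (h : HasDerivWithinAt φ κ (Icc 0 L) x) :
    beamCurvature L φ x = κ :=
  h.derivWithin (uniqueDiffOn_Icc (hx.1.trans_le hx.2) x (Ioc_subset_Icc_self hx))

theorem IsPendulumOn.exists_isCantileverState {c : ℝ} {ψ κ : ℝ → ℝ}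
    (h : IsPendulumOn c univ ψ κ) (hEI : EI ≠ 0) (hκ : κ 0 = 0) (hψ : ψ L = α) :
    ∃ u w : ℝ → ℝ, IsCantileverState EI L α (EI * c) (fun x => ψ x - α) u w := by
  have hcont : Continuous ψ := continuousOn_univ.1 h.continuousOn_angle
  obtain ⟨u, hu, huL⟩ : ∃ u, (∀ x, HasDerivAt u (cos (ψ x - α) - 1) x) ∧ u L = 0 :=
    ⟨fun x => ∫ t in L..x, (cos (ψ t - α) - 1), fun x =>
      (Continuous.integral_hasStrictDerivAt (by fun_prop) L x).hasDerivAt,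
      intervalIntegral.integral_same⟩
  obtain ⟨w, hw, hwL⟩ : ∃ w, (∀ x, HasDerivAt w (-sin (ψ x - α)) x) ∧ w L = 0 :=
    ⟨fun x => ∫ t in L..x, -sin (ψ t - α), fun x =>
      (Continuous.integral_hasStrictDerivAt (by fun_prop) L x).hasDerivAt,
      intervalIntegral.integral_same⟩
  have hdiff (x : ℝ) :
      HasDerivWithinAt (fun x => κ x - momentCurvature EI α (EI * c) u w x) 0 univ x := by
    have hcurv := hasDerivWithinAt_momentCurvature (EI := EI) (α := α) (F := EI * c)
      (φ := fun x => ψ x - α) (s := univ) (hu x).hasDerivWithinAt (hw x).hasDerivWithinAt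
    refine ((h.hasDerivWithinAt_velocity x (mem_univ x)).sub hcurv).congr_deriv ?_
    rw [mul_div_cancel_left₀ c hEI, add_sub_cancel, sub_self]
  have hκ_eq (x : ℝ) : κ x = momentCurvature EI α (EI * c) u w x := by
    have := eq_of_hasDerivWithinAt_zero convex_univ (fun x _ => hdiff x) (mem_univ x) (mem_univ 0)
    rwa [hκ, momentCurvature_zero, sub_self, sub_eq_zero] at this
  refine ⟨u, w, ⟨fun x _ => ?_, fun x _ => (hu x).hasDerivWithinAt,
    fun x _ => (hw x).hasDerivWithinAt⟩, sub_eq_zero.2 hψ, huL, hwL⟩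
  rw [← momentCurvature_eq, ← hκ_eq]
  exact ((h.hasDerivWithinAt_angle x (mem_univ x)).mono (subset_univ _)).sub_const α

theorem exists_isCantileverState_of_rotation {φa : ℝ} (hEI : EI ≠ 0) (hL : 0 < L) (hα : 0 ≤ α)
    (hφa : 0 < φa) (hπ : α + φa < π) :
    ∃ φ u w : ℝ → ℝ, IsCantileverState EI L α (EI * (cantileverB α φa / L) ^ 2) φ u w ∧
      (∀ x ∈ Ioc 0 L, beamCurvature L φ x < 0) ∧ φ 0 = φa := by
  have habs : |α + φa| < π := abs_lt.2 ⟨by linarith, hπ⟩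
  set k := sin ((α + φa) / 2) with hk_def
  set ω := cantileverB α φa / L
  have hk : k ^ 2 < 1 := sin_half_sq_lt_one habs
  have hk0 : 0 < k := sin_pos_of_pos_of_lt_pi (by linarith) (by linarith)
  have hω : 0 < ω := div_pos (cantileverB_pos hα hφa hπ) hL
  have hθ : pendulumAmplitude k ω L = clampAmplitude α φa :=
    (pendulumAmplitude_eq_iff hk).2 (div_mul_cancel₀ _ hL.ne')
  have hend : pendulumAngle k ω L = α := by
    rw [pendulumAngle, hθ, hk_def, sin_half_mul_sin_clampAmplitude hα hφa hπ.le,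
      two_mul_arcsin_sin_half (abs_le.2 ⟨by linarith, by linarith⟩)]
  obtain ⟨u, w, h⟩ := (isPendulumOn_pendulumAngle hk ω univ).exists_isCantileverState hEI
    (pendulumVelocity_zero hk ω) hend
  refine ⟨_, u, w, h, fun x hx => ?_, ?_⟩
  · have hamp : -(π / 2) < pendulumAmplitude k ω x := by
      have := (strictAnti_pendulumAmplitude hk hω).antitone hx.2
      linarith [clampAmplitude_nonneg α φa, pi_pos]
    rw [beamCurvature_eq hx ((hasDerivAt_pendulumAngle hk ω x).sub_const α).hasDerivWithinAt]
    exact pendulumVelocity_neg hk hk0 hω hx.1 hamp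
  · rw [pendulumAngle_zero hk, hk_def, two_mul_arcsin_sin_half habs.le, add_sub_cancel_left]

end LoadFrame

/-- An equilibrium state of the cantilever whose curvature is negative away from the free end,
together with the admissible ranges of the parameters. -/
structure IsNegativelyCurvedState (EI L α F : ℝ) (φ u w : ℝ → ℝ) : Prop
    extends IsCantileverState EI L α F φ u w where
  stiffness_pos : 0 < EI
  length_pos : 0 < L
  force_nonneg : 0 ≤ F
  inclination_mem : α ∈ Ico 0 π
  curvature_neg : ∀ x ∈ Ioc 0 L, beamCurvature L φ x < 0

namespace IsNegativelyCurvedState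

variable {EI L α F x : ℝ} {φ u w : ℝ → ℝ}

theorem momentCurvature_neg (h : IsNegativelyCurvedState EI L α F φ u w) (hx : x ∈ Ioc 0 L) :
    momentCurvature EI α F u w x < 0 := by
  have hderiv := h.beam.moment x (Ioc_subset_Icc_self hx)
  rw [← momentCurvature_eq] at hderiv
  exact beamCurvature_eq hx hderiv ▸ h.curvature_neg x hx

theorem frequency_pos (h : IsNegativelyCurvedState EI L α F φ u w) : 0 < √(F / EI) := by
  have hF : F ≠ 0 := by
    rintro rfl
    simpa [momentCurvature] using h.momentCurvature_neg (right_mem_Ioc.2 h.length_pos)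
  exact sqrt_pos.2 (div_pos (h.force_nonneg.lt_of_ne' hF) h.stiffness_pos)

theorem frequency_sq (h : IsNegativelyCurvedState EI L α F φ u w) : √(F / EI) ^ 2 = F / EI :=
  sq_sqrt (div_nonneg h.force_nonneg h.stiffness_pos.le)

theorem rotation_zero_pos (h : IsNegativelyCurvedState EI L α F φ u w) : 0 < φ 0 := by
  have hanti := h.isPendulumOn.strictAntiOn_angle fun x hx =>
    h.momentCurvature_neg (Ioo_subset_Ioc_self hx)
  have hlt := hanti (left_mem_Icc.2 h.length_pos.le) (right_mem_Icc.2 h.length_pos.le) h.length_pos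
  simpa [h.clamped_rotation] using hlt

theorem add_rotation_zero_lt_pi (h : IsNegativelyCurvedState EI L α F φ u w) : α + φ 0 < π := by
  refine h.isPendulumOn.angle_left_lt_pi (div_nonneg h.force_nonneg h.stiffness_pos.le)
    h.length_pos.le (momentCurvature_zero EI α F u w)
    (h.momentCurvature_neg (right_mem_Ioc.2 h.length_pos)).ne ?_
  simpa [h.clamped_rotation] using h.inclination_mem.2

theorem cantileverB_pos (h : IsNegativelyCurvedState EI L α F φ u w) : 0 < cantileverB α (φ 0) :=
  _root_.cantileverB_pos h.inclination_mem.1 h.rotation_zero_pos h.add_rotation_zero_lt_pi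

theorem abs_add_rotation_zero_lt_pi (h : IsNegativelyCurvedState EI L α F φ u w) :
    |α + φ 0| < π :=
  abs_lt.2 ⟨by linarith [h.inclination_mem.1, h.rotation_zero_pos, pi_pos],
    h.add_rotation_zero_lt_pi⟩

theorem eqOn_pendulumAngle (h : IsNegativelyCurvedState EI L α F φ u w) :
    EqOn (fun x => α + φ x) (pendulumAngle (sin ((α + φ 0) / 2)) √(F / EI)) (Icc 0 L) ∧
      EqOn (momentCurvature EI α F u w) (pendulumVelocity (sin ((α + φ 0) / 2)) √(F / EI))
        (Icc 0 L) := by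
  have hpend := h.isPendulumOn
  rw [← h.frequency_sq] at hpend
  exact hpend.eqOn_pendulumAngle h.abs_add_rotation_zero_lt_pi (momentCurvature_zero EI α F u w)

theorem pendulumAmplitude_length (h : IsNegativelyCurvedState EI L α F φ u w) :
    pendulumAmplitude (sin ((α + φ 0) / 2)) √(F / EI) L = clampAmplitude α (φ 0) := by
  have hk := sin_half_sq_lt_one h.abs_add_rotation_zero_lt_pi
  obtain ⟨hα, -⟩ := h.inclination_mem
  have hφ := h.rotation_zero_pos
  have hπ := h.add_rotation_zero_lt_pi
  have hmem := pendulumAmplitude_mem_Ioo hk h.frequency_pos h.length_pos fun x hx =>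
    (h.eqOn_pendulumAngle.2 (Ioc_subset_Icc_self hx)).symm.trans_ne (h.momentCurvature_neg hx).ne
  have hend : pendulumAngle (sin ((α + φ 0) / 2)) √(F / EI) L = α := by
    simpa only [h.clamped_rotation, add_zero, eq_comm] using
      h.eqOn_pendulumAngle.1 (right_mem_Icc.2 h.length_pos.le)
  have hsin : sin ((α + φ 0) / 2) * sin (pendulumAmplitude (sin ((α + φ 0) / 2)) √(F / EI) L) =
      sin ((α + φ 0) / 2) * sin (clampAmplitude α (φ 0)) := by
    rw [sin_half_mul_sin_clampAmplitude hα hφ hπ.le, ← sin_half_pendulumAngle hk, hend]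
  have hk0 : sin ((α + φ 0) / 2) ≠ 0 :=
    (sin_pos_of_pos_of_lt_pi (by linarith) (by linarith)).ne'
  exact injOn_sin (Ioo_subset_Icc_self hmem)
    ⟨by linarith [clampAmplitude_nonneg α (φ 0), pi_pos],
      (clampAmplitude_lt_pi_div_two hα hφ hπ.le).le⟩ (mul_left_cancel₀ hk0 hsin)

theorem length_mul_frequency (h : IsNegativelyCurvedState EI L α F φ u w) :
    L * √(F / EI) = cantileverB α (φ 0) := by
  rw [mul_comm, cantileverB_eq]
  exact (pendulumAmplitude_eq_iff (sin_half_sq_lt_one h.abs_add_rotation_zero_lt_pi)).1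
    h.pendulumAmplitude_length

theorem force_eq (h : IsNegativelyCurvedState EI L α F φ u w) :
    F = EI / L ^ 2 * cantileverB α (φ 0) ^ 2 := by
  have hEI := h.stiffness_pos.ne'
  have hL := h.length_pos.ne'
  rw [← h.length_mul_frequency, mul_pow, h.frequency_sq]
  field_simp

theorem loadAbscissa_zero (h : IsNegativelyCurvedState EI L α F φ u w) :
    loadAbscissa α u w 0 = L * (1 + cos α) - 2 * L / cantileverB α (φ 0) *
      (ellipticE (sin ((α + φ 0) / 2)) - cantileverD α (φ 0)) := by
  have hk := sin_half_sq_lt_one h.abs_add_rotation_zero_lt_pi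
  have hconst := eq_of_hasDerivWithinAt_zero (convex_Icc 0 L)
    (f := fun x => 2 * ellipticEJ (pendulumAmplitude (sin ((α + φ 0) / 2)) √(F / EI) x)
      (sin ((α + φ 0) / 2)) + √(F / EI) * (x + loadAbscissa α u w x)) (fun x hx => by
      refine ((hasDerivAt_ellipticEJ_pendulumAmplitude hk √(F / EI) x).hasDerivWithinAt.add
        (((hasDerivWithinAt_id x _).add (hasDerivWithinAt_loadAbscissa (h.beam.axial x hx)
          (h.beam.transversal x hx))).const_mul √(F / EI))).congr_deriv ?_
      rw [← h.eqOn_pendulumAngle.1 hx]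
      ring) (left_mem_Icc.2 h.length_pos.le) (right_mem_Icc.2 h.length_pos.le)
  have hlength : loadAbscissa α u w L = L * cos α := by
    rw [loadAbscissa, h.clamped_axial, h.clamped_transversal]
    ring
  have hD : cantileverD α (φ 0) =
    ellipticEJ (clampAmplitude α (φ 0)) (sin ((α + φ 0) / 2)) := rfl
  have hω := h.frequency_pos.ne'
  have hL := h.length_pos.ne'
  rw [pendulumAmplitude_zero hk, h.pendulumAmplitude_length, hlength, ← hD, ← ellipticE] at hconst
  rw [← h.length_mul_frequency]
  field_simp
  linear_combination hconst

theorem loadOrdinate_zero (h : IsNegativelyCurvedState EI L α F φ u w) :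
    loadOrdinate α u w 0 = L / cantileverB α (φ 0) * √(2 * cos α - 2 * cos (α + φ 0)) -
      L * sin α := by
  have hω := h.frequency_pos
  have hL := h.length_pos
  have henergy : momentCurvature EI α F u w L ^ 2 =
      √(F / EI) ^ 2 * (2 * cos α - 2 * cos (α + φ 0)) := by
    rw [h.isPendulumOn.velocity_sq (convex_Icc 0 L) (left_mem_Icc.2 hL.le)
      (right_mem_Icc.2 hL.le), momentCurvature_zero, h.clamped_rotation, add_zero, h.frequency_sq]
    ring
  have hcurv : momentCurvature EI α F u w L =
      -(√(F / EI) * √(2 * cos α - 2 * cos (α + φ 0))) := by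
    rw [← sqrt_sq hω.le, ← sqrt_mul (sq_nonneg _), ← henergy, sqrt_sq_eq_abs,
      abs_of_neg (h.momentCurvature_neg (right_mem_Ioc.2 hL)), neg_neg]
  have hlength : loadOrdinate α u w L = -(L * sin α) := by
    rw [loadOrdinate, h.clamped_axial, h.clamped_transversal]
    ring
  rw [momentCurvature, hlength] at hcurv
  rw [← h.length_mul_frequency, mul_comm L √(F / EI), div_mul_cancel_right₀ hL.ne']
  refine mul_left_cancel₀ (pow_ne_zero 2 hω.ne') ?_
  have hinv : √(F / EI) ^ 2 * (√(F / EI))⁻¹ = √(F / EI) := by rw [sq, mul_self_mul_inv]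
  linear_combination (loadOrdinate α u w 0 + L * sin α) * h.frequency_sq - hcurv -
    √(2 * cos α - 2 * cos (α + φ 0)) * hinv

theorem axial_displacement_zero (h : IsNegativelyCurvedState EI L α F φ u w) :
    u 0 = L * (1 + cos α)
      - L * sin α / cantileverB α (φ 0) * √(2 * cos α - 2 * cos (α + φ 0))
      - 2 * L * cos α / cantileverB α (φ 0)
        * (ellipticE (sin ((α + φ 0) / 2)) - cantileverD α (φ 0)) := by
  rw [← zero_add (u 0), ← cos_mul_loadAbscissa_sub α u w 0, h.loadAbscissa_zero,
    h.loadOrdinate_zero]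
  linear_combination L * sin_sq_add_cos_sq α

theorem transversal_displacement_zero (h : IsNegativelyCurvedState EI L α F φ u w) :
    w 0 = L * sin α
      + L * cos α / cantileverB α (φ 0) * √(2 * cos α - 2 * cos (α + φ 0))
      - 2 * L * sin α / cantileverB α (φ 0)
        * (ellipticE (sin ((α + φ 0) / 2)) - cantileverD α (φ 0)) := by
  rw [← sin_mul_loadAbscissa_add α u w 0, h.loadAbscissa_zero, h.loadOrdinate_zero]
  ring

theorem displacement_along_load_zero (h : IsNegativelyCurvedState EI L α F φ u w) :
    u 0 * cos α + w 0 * sin α = L * (1 + cos α) - 2 * L / cantileverB α (φ 0) *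
      (ellipticE (sin ((α + φ 0) / 2)) - cantileverD α (φ 0)) := by
  rw [← h.loadAbscissa_zero, loadAbscissa]
  ring

end IsNegativelyCurvedState

section AxialCompression

theorem IsNegativelyCurvedState.axial_compression {EI L F : ℝ} {φ u w : ℝ → ℝ}
    (h : IsNegativelyCurvedState EI L 0 F φ u w) :
    F = axialForce EI L (φ 0) ∧ u 0 = axialU L (φ 0) ∧ w 0 = axialW L (φ 0) := by
  have hsqrt : √(2 - 2 * cos (φ 0)) = 2 * sin (φ 0 / 2) := by
    have hπ := h.add_rotation_zero_lt_pi
    have hle : φ 0 ≤ 2 * π := by linarith [pi_pos]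
    rw [sin_half_eq_sqrt h.rotation_zero_pos.le hle,
      show 2 - 2 * cos (φ 0) = 2 ^ 2 * ((1 - cos (φ 0)) / 2) by ring, sqrt_mul (sq_nonneg 2),
      sqrt_sq zero_le_two]
  refine ⟨?_, ?_, ?_⟩
  · rw [h.force_eq, cantileverB_axial, axialForce]
  · have hu := h.axial_displacement_zero
    simp only [cantileverB_axial, cantileverD_axial, zero_add, cos_zero, sin_zero] at hu
    rw [hu, axialU]
    ring
  · have hw := h.transversal_displacement_zero
    simp only [cantileverB_axial, zero_add, cos_zero, sin_zero, mul_one, hsqrt] at hw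
    rw [hw, axialW]
    ring

theorem continuousOn_ellipticK_sin_half :
    ContinuousOn (fun φ => ellipticK (sin (φ / 2))) (Ioo (-π) π) :=
  continuousOn_ellipticK.comp (by fun_prop) fun _ hφ => sin_half_sq_lt_one (abs_lt.2 hφ)

theorem ellipticK_sin_half_ne_zero {φ : ℝ} (hφ : φ ∈ Ioo (-π) π) : ellipticK (sin (φ / 2)) ≠ 0 :=
  (ellipticK_pos (sin_half_sq_lt_one (abs_lt.2 hφ))).ne'

theorem continuousOn_axialForce (EI L : ℝ) : ContinuousOn (axialForce EI L) (Ioo (-π) π) :=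
  continuousOn_const.mul (continuousOn_ellipticK_sin_half.pow 2)

theorem continuousOn_axialU (L : ℝ) : ContinuousOn (axialU L) (Ioo (-π) π) :=
  have hE : Continuous fun φ : ℝ => ellipticE (sin (φ / 2)) :=
    continuous_ellipticE.comp (by fun_prop)
  continuousOn_const.mul (continuousOn_const.sub (hE.continuousOn.div
    continuousOn_ellipticK_sin_half fun _ => ellipticK_sin_half_ne_zero))

theorem continuousOn_axialW (L : ℝ) : ContinuousOn (axialW L) (Ioo (-π) π) :=
  ContinuousOn.div (by fun_prop) continuousOn_ellipticK_sin_half fun _ => ellipticK_sin_half_ne_zero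

theorem axialForce_zero (EI L : ℝ) : axialForce EI L 0 = EI * π ^ 2 / (4 * L ^ 2) := by
  rw [axialForce, zero_div, sin_zero, ellipticK_zero]
  ring

theorem axialU_zero (L : ℝ) : axialU L 0 = 0 := by
  simp [axialU, ellipticK_zero, ellipticE_zero, pi_ne_zero]

theorem axialW_zero (L : ℝ) : axialW L 0 = 0 := by simp [axialW]

end AxialCompression

end

theorem mainTheorem3 (EI L : ℝ) (hEI : 0 < EI) (hL : 0 < L) :
    -- inclined force: every state with negative curvature obeys the closed-form relations
    (∀ α ∈ Set.Ico 0 Real.pi, ∀ F : ℝ, 0 ≤ F → ∀ φ u w : ℝ → ℝ,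
      IsCantileverState EI L α F φ u w →
      (∀ x ∈ Set.Ioc 0 L, beamCurvature L φ x < 0) →
        0 < φ 0 ∧ α + φ 0 < Real.pi ∧ 0 < cantileverB α (φ 0) ∧
        L * Real.sqrt (F / EI) = cantileverB α (φ 0) ∧
        F = EI / L ^ 2 * cantileverB α (φ 0) ^ 2 ∧
        u 0 = L * (1 + Real.cos α)
          - L * Real.sin α / cantileverB α (φ 0)
            * Real.sqrt (2 * Real.cos α - 2 * Real.cos (α + φ 0))
          - 2 * L * Real.cos α / cantileverB α (φ 0)
            * (ellipticE (Real.sin ((α + φ 0) / 2)) - cantileverD α (φ 0)) ∧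
        w 0 = L * Real.sin α
          + L * Real.cos α / cantileverB α (φ 0)
            * Real.sqrt (2 * Real.cos α - 2 * Real.cos (α + φ 0))
          - 2 * L * Real.sin α / cantileverB α (φ 0)
            * (ellipticE (Real.sin ((α + φ 0) / 2)) - cantileverD α (φ 0)) ∧
        u 0 * Real.cos α + w 0 * Real.sin α = L * (1 + Real.cos α)
          - 2 * L / cantileverB α (φ 0)
            * (ellipticE (Real.sin ((α + φ 0) / 2)) - cantileverD α (φ 0))) ∧
    -- the end rotation parametrizes these states
    (∀ α ∈ Set.Ico 0 Real.pi, ∀ φa : ℝ, 0 < φa → α + φa < Real.pi → ∀ F : ℝ, 0 ≤ F →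
      ((∃ φ u w : ℝ → ℝ, IsCantileverState EI L α F φ u w ∧
          (∀ x ∈ Set.Ioc 0 L, beamCurvature L φ x < 0) ∧ φ 0 = φa) ↔
        F = EI / L ^ 2 * cantileverB α φa ^ 2)) ∧
    -- axial compression
    (∀ φa ∈ Set.Ioo 0 Real.pi,
      cantileverB 0 φa = ellipticK (Real.sin (φa / 2)) ∧ cantileverD 0 φa = 0) ∧
    (∀ F : ℝ, 0 ≤ F → ∀ φ u w : ℝ → ℝ,
      IsCantileverState EI L 0 F φ u w →
      (∀ x ∈ Set.Ioc 0 L, beamCurvature L φ x < 0) →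
        F = axialForce EI L (φ 0) ∧ u 0 = axialU L (φ 0) ∧ w 0 = axialW L (φ 0)) ∧
    -- no singularity at zero end rotation, where the Euler load is recovered
    ellipticK 0 = Real.pi / 2 ∧ ellipticE 0 = Real.pi / 2 ∧
    ContinuousAt (axialForce EI L) 0 ∧ ContinuousAt (axialU L) 0 ∧ ContinuousAt (axialW L) 0 ∧
    axialForce EI L 0 = EI * Real.pi ^ 2 / (4 * L ^ 2) ∧ axialU L 0 = 0 ∧ axialW L 0 = 0 := by
  have hnhds : Set.Ioo (-Real.pi) Real.pi ∈ nhds 0 :=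
    Ioo_mem_nhds (neg_neg_of_pos Real.pi_pos) Real.pi_pos
  refine ⟨fun α hα F hF φ u w hstate hneg => ?_, fun α hα φa hφa hπ F hF => ⟨?_, ?_⟩,
    fun φa _ => ⟨cantileverB_axial φa, cantileverD_axial φa⟩, fun F hF φ u w hstate hneg => ?_,
    ellipticK_zero, ellipticE_zero, (continuousOn_axialForce EI L).continuousAt hnhds,
    (continuousOn_axialU L).continuousAt hnhds, (continuousOn_axialW L).continuousAt hnhds,
    axialForce_zero EI L, axialU_zero L, axialW_zero L⟩
  · have h : IsNegativelyCurvedState EI L α F φ u w := ⟨hstate, hEI, hL, hF, hα, hneg⟩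
    exact ⟨h.rotation_zero_pos, h.add_rotation_zero_lt_pi, h.cantileverB_pos,
      h.length_mul_frequency, h.force_eq, h.axial_displacement_zero,
      h.transversal_displacement_zero, h.displacement_along_load_zero⟩
  · rintro ⟨φ, u, w, hstate, hneg, rfl⟩
    have h : IsNegativelyCurvedState EI L α F φ u w := ⟨hstate, hEI, hL, hF, hα, hneg⟩
    exact h.force_eq
  · rintro rfl
    rw [div_mul_eq_mul_div, mul_div_assoc, ← div_pow]
    exact exists_isCantileverState_of_rotation hEI.ne' hL hα.1 hφa hπ
  · have h : IsNegativelyCurvedState EI L 0 F φ u w :=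
      ⟨hstate, hEI, hL, hF, ⟨le_rfl, Real.pi_pos⟩, hneg⟩
    exact h.axial_compression
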